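/- Let $k$ be a field and let $\mathcal T$ be a $k$-linear compactly generated triangulated category, i.e. $\mathcal T$ has all set-indexed coproducts and there is a set $\mathcal G$ of compact objects such that $y=0$ whenever $\mathrm{Hom}_{\mathcal T}(g,y[n])=0$ for all $g\in\mathcal G$, $n\in\mathbb Z$; here $x$ is compact if $\mathrm{Hom}_{\mathcal T}(x,-)$ commutes with coproducts, and $\mathcal T^{\mathsf c}$ denotes the full subcategory of compact objects. Let $M$ be a compact silting object of $\mathcal T$, i.e. $M\in\mathcal T^{\mathsf c}$, $\mathrm{Hom}_{\mathcal T}(M,M[i])=0$ for all $i>0$, and the smallest thick subcategory of $\mathcal T$ containing $M$ is $\mathcal T^{\mathsf c}$. Let $$\mathcal H_M=\{y\in\mathcal T:\mathrm{Hom}_{\mathcal T}(M,y[i])=0\text{ for all }i\neq 0\}$$ (the heart of the t-structure on $\mathcal T$ with aisle $\{y:\mathrm{Hom}_{\mathcal T}(M,y[i])=0\ \forall i>0\}$ and coaisle $\{y:\mathrm{Hom}_{\mathcal T}(M,y[i])=0\ \forall i\le 0\}$), and let $\mathcal T^{\mathsf b}_c$ be the triangulated subcategory of those $y\in\mathcal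 T$ for which $\bigoplus_{n\in\mathbb Z}\mathrm{Hom}_{\mathcal T}(x,y[n])$ is finite-dimensional over $k$ for every $x\in\mathcal T^{\mathsf c}$. Assume that there is an object $s\in\mathcal H_M\cap\mathcal T^{\mathsf b}_c$ such that 1. every $x\in\mathcal H_M$ admits a finite filtration $0=x_0\subseteq x_1\subseteq\dots\subseteq x_n=x$ in the abelian category $\mathcal H_M$ with all quotients $x_{j+1}/x_j$ in $\mathsf{Add}\,s$, the class of direct summands of set-indexed coproducts in $\mathcal T$ of copies of $s$; and 2. the functor $\mathrm{Hom}_{\mathcal T}(s,-)\colon\mathcal H_M\to\mathsf{Ab}$ commutes with set-indexed coproducts. Assume moreover that $\mathcal T^{\mathsf b}_c$ admits a Serre functor, i.e. a triangle equivalence $\mathrm S\colon\mathcal T^{\mathsf b}_c\to\mathcal T^{\mathsf b}_c$ with $k$-linear isomorphisms $\mathrm{Hom}(x,y)\cong\mathrm{Hom}(y,\mathrm S(x))^{\vee}$ for all $x,y\in\mathcal T^{\mathsf b}_c$, where $(-)^\vee$ is the $k$-dual. Then $\mathrm{gl.dim}_{\mathcal H_M}\mathcal T<\infty$. Here $\mathrm{pd}_{\mathcal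 H_M}x$ is the minimum of the integers $n$ with $\mathrm{Hom}_{\mathcal T}(x,y[m])=0$ for all $y\in\mathcal H_M$ and all $m>n$ (and is $\infty$ if there is no such $n$), and $\mathrm{gl.dim}_{\mathcal H_M}\mathcal T$ is the minimum of the integers $n$ with $\mathrm{pd}_{\mathcal H_M}x\le n$ for all $x\in\mathcal H_M$ (and is $\infty$ if there is no such $n$); a minimum over all of $\mathbb Z$ is read as $-\infty$. -/

import Mathlib

open CategoryTheory CategoryTheory.Limits CategoryTheory.Pretriangulated
open scoped DirectSum

universe w v u

namespace RelGlobalDim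

section Triangulated

variable {C : Type u} [Category.{v} C] [Preadditive C] [HasZeroObject C] [HasShift C ℤ]
  [∀ n : ℤ, (shiftFunctor C n).Additive] [Pretriangulated C]

variable (C) in
/-- The compact objects `T^c`: those `X` for which `Hom(X, -) : T ⥤ Ab` preserves all
(small) coproducts. -/
def compactObjects : ObjectProperty C := fun X =>
  ∀ J : Type v, PreservesColimitsOfShape (Discrete J) (preadditiveCoyoneda.obj (Opposite.op X))

variable (C) in
/-- `T` is compactly generated: it has all small coproducts, and there is a (small) set of compact
objects such that an object receiving no nonzero morphism from any shift of them is zero. -/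
structure IsCompactlyGenerated : Prop where
  hasCoproducts : HasCoproducts.{v} C
  exists_generators : ∃ (ι : Type v) (G : ι → C), (∀ i, compactObjects C (G i)) ∧
    ∀ Y : C, (∀ (i : ι) (n : ℤ) (f : G i ⟶ Y⟦n⟧), f = 0) → IsZero Y

/-- `M` is a compact silting object: it is compact, `Hom(M, M[i]) = 0` for all `i > 0`, and the
smallest thick (triangulated, closed under direct summands) subcategory containing `M` is `T^c`. -/
structure IsCompactSilting (M : C) : Prop where
  compact : compactObjects C M
  hom_shift_eq_zero : ∀ i : ℤ, 0 < i → ∀ f : M ⟶ M⟦i⟧, f = 0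
  thick_eq : (ObjectProperty.singleton M).triangEnvelope = compactObjects C

/-- The heart `H_M = {y | Hom(M, y[i]) = 0 for all i ≠ 0}` attached to `M`. -/
def siltingHeart (M : C) : ObjectProperty C := fun Y =>
  ∀ i : ℤ, i ≠ 0 → ∀ f : M ⟶ Y⟦i⟧, f = 0

/-- `Add s`: the direct summands of the (small) coproducts in `T` of copies of `s`. -/
def addClosure (s : C) : ObjectProperty C := fun Y =>
  ∃ (J : Type v) (c : Cofan (fun _ : J => s)), Nonempty (IsColimit c) ∧ Nonempty (Retract Y c.pt)

/-- `x ∈ H` has a finite filtration `0 = x₀ ⊆ x₁ ⊆ ⋯ ⊆ xₙ ≅ x` in the category `H`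
(a full subcategory of `T`), with all the quotients `xⱼ₊₁ / xⱼ` (computed in `H`) in `A`. -/
def HasFiniteFiltration (H A : ObjectProperty C) (x : H.FullSubcategory) : Prop :=
  ∃ (n : ℕ) (F : ℕ → H.FullSubcategory) (i : ∀ j, F j ⟶ F (j + 1)),
    IsZero (F 0) ∧ Nonempty (F n ≅ x) ∧
      ∀ j < n, Mono (i j) ∧
        ∃ (Q : H.FullSubcategory) (p : F (j + 1) ⟶ Q) (h : i j ≫ p = 0),
          Nonempty (IsColimit (CokernelCofork.ofπ p h)) ∧ A Q.obj

/-- The projective dimension of `x` relative to `H`: the minimum of the integers `n` such that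
`Hom(x, y[m]) = 0` for all `y ∈ H` and all `m > n`; it is `⊤` if there is no such `n`
(and `⊥` if every integer has this property, as for `x = 0`). -/
noncomputable def projDim (H : ObjectProperty C) (x : C) : WithBot (WithTop ℤ) :=
  sInf ((fun n : ℤ => ((n : WithTop ℤ) : WithBot (WithTop ℤ))) ''
    {n | ∀ y, H y → ∀ m : ℤ, n < m → ∀ f : x ⟶ y⟦m⟧, f = 0})

/-- The global dimension of `T` relative to `H`: the minimum of the integers `n` such that
`projDim H x ≤ n` for all `x ∈ H`; it is `⊤` if there is no such `n`
(and `⊥` if every integer has this property, as for `T = 0`). -/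
noncomputable def globalDim (H : ObjectProperty C) : WithBot (WithTop ℤ) :=
  sInf ((fun n : ℤ => ((n : WithTop ℤ) : WithBot (WithTop ℤ))) ''
    {n | ∀ x, H x → projDim H x ≤ ((n : WithTop ℤ) : WithBot (WithTop ℤ))})

end Triangulated

section Linear

variable (k : Type w) [Field k]

/-- A Serre functor on a `k`-linear triangulated category `D`: a triangle equivalence
`S : D ⥤ D` with `k`-linear isomorphisms `Hom(X, Y) ≅ Hom(Y, S X)^∨` for all `X`, `Y`.
Naturality of the isomorphisms is not demanded. -/
structure SerreFunctor (D : Type u) [Category.{v} D] [Preadditive D] [Linear k D]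
    [HasZeroObject D] [HasShift D ℤ] [∀ n : ℤ, (shiftFunctor D n).Additive]
    [Pretriangulated D] where
  functor : D ⥤ D
  [commShift : functor.CommShift ℤ]
  [isTriangulated : functor.IsTriangulated]
  [isEquivalence : functor.IsEquivalence]
  dualIso : ∀ X Y : D, (X ⟶ Y) ≃ₗ[k] Module.Dual k (Y ⟶ functor.obj X)

variable (C : Type u) [Category.{v} C] [Preadditive C] [Linear k C] [HasZeroObject C]
  [HasShift C ℤ] [∀ n : ℤ, (shiftFunctor C n).Additive] [Pretriangulated C]

/-- The subcategory `T^b_c`: the objects `Y` such that `⨁_{n ∈ ℤ} Hom(X, Y[n])` is a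
finite-dimensional `k`-vector space for every compact object `X`. -/
def boundedFinite : ObjectProperty C := fun Y =>
  ∀ X : C, compactObjects C X → Module.Finite k (⨁ n : ℤ, (X ⟶ Y⟦n⟧))

variable {C}

/-- Postcomposition with the shifts of a morphism, on graded `Hom` spaces. -/
noncomputable def gradedPostcomp (X : C) {Y Z : C} (g : Y ⟶ Z) :
    (⨁ n : ℤ, (X ⟶ Y⟦n⟧)) →ₗ[k] (⨁ n : ℤ, (X ⟶ Z⟦n⟧)) :=
  DirectSum.lmap fun n => Linear.rightComp k X (g⟦n⟧')

variable (C)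

instance boundedFinite_isClosedUnderIsomorphisms :
    (boundedFinite k C).IsClosedUnderIsomorphisms where
  of_iso {Y Z} e hY X hX := by
    have := hY X hX
    refine Module.Finite.of_surjective (gradedPostcomp k X e.hom) ?_
    refine (DirectSum.lmap_surjective _).2 fun n f => ⟨f ≫ e.inv⟦n⟧', ?_⟩
    simp [Linear.rightComp, ← Functor.map_comp]

/-- `T^b_c` is a triangulated subcategory of `T`. -/
instance boundedFinite_isTriangulated : (boundedFinite k C).IsTriangulated where
  exists_zero := by
    obtain ⟨Z, hZ⟩ := HasZeroObject.zero (C := C)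
    refine ⟨Z, hZ, fun X _ => ?_⟩
    have h : ∀ n : ℤ, Subsingleton (X ⟶ Z⟦n⟧) := fun n =>
      ⟨fun f g => (Functor.map_isZero (shiftFunctor C n) hZ).eq_of_tgt f g⟩
    have : Subsingleton (⨁ n : ℤ, (X ⟶ Z⟦n⟧)) :=
      ⟨fun a b => DFinsupp.ext fun n => (h n).elim _ _⟩
    infer_instance
  isStableUnderShiftBy a :=
    { le_shift := fun Y hY X hX => by
        have := hY X hX
        let φ : (⨁ n : ℤ, (X ⟶ Y⟦n⟧)) →ₗ[k] (⨁ n : ℤ, (X ⟶ (Y⟦a⟧)⟦n⟧)) :=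
          DirectSum.toModule k ℤ _ fun m =>
            (DirectSum.lof k ℤ (fun n => (X ⟶ (Y⟦a⟧)⟦n⟧)) (m - a)).comp
              (Linear.homCongr k (Iso.refl X)
                ((shiftFunctorAdd' C a (m - a) m (by omega)).app Y)).toLinearMap
        refine Module.Finite.of_surjective φ ?_
        rw [← LinearMap.range_eq_top, eq_top_iff]
        rintro z -
        induction z using DirectSum.induction_on with
        | zero => exact zero_mem _
        | add _ _ hx hy => exact add_mem hx hy
        | of n f =>
          obtain ⟨m, rfl⟩ : ∃ m, m - a = n := ⟨n + a, by omega⟩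
          obtain ⟨g, hg⟩ := (Linear.homCongr k (Iso.refl X)
              ((shiftFunctorAdd' C a (m - a) m (by omega)).app Y)).surjective f
          refine ⟨DirectSum.lof k ℤ _ m g, ?_⟩
          simp only [φ, DirectSum.toModule_lof]
          rw [LinearMap.comp_apply]
          exact congrArg (DirectSum.lof k ℤ (fun n => (X ⟶ (Y⟦a⟧)⟦n⟧)) (m - a)) hg }
  toIsTriangulatedClosed₂ := .mk' fun T hT h₁ h₃ X hX => by
    have := h₁ X hX
    have := h₃ X hX
    have : IsNoetherian k (⨁ n : ℤ, (X ⟶ T.obj₂⟦n⟧)) := by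
      refine isNoetherian_of_range_eq_ker (gradedPostcomp k X T.mor₁) (gradedPostcomp k X T.mor₂) ?_
      simp only [gradedPostcomp, DirectSum.range_lmap, DirectSum.ker_lmap]
      congr 2
      funext n
      have hn := Triangle.shift_distinguished T hT n
      ext f
      simp only [LinearMap.mem_range, LinearMap.mem_ker, Linear.rightComp_apply]
      constructor
      · rintro ⟨g, rfl⟩
        rw [Category.assoc, ← Functor.map_comp, comp_distTriang_mor_zero₁₂ _ hT, Functor.map_zero,
          comp_zero]
      · intro hf
        have hf' : f ≫ (n.negOnePow • T.mor₂⟦n⟧') = 0 := by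
          rcases Int.units_eq_one_or n.negOnePow with h | h <;> simp [h, hf]
        obtain ⟨g, hg⟩ : ∃ g : X ⟶ T.obj₁⟦n⟧, f = g ≫ (n.negOnePow • T.mor₁⟦n⟧') :=
          Triangle.coyoneda_exact₂ _ hn f hf'
        rcases Int.units_eq_one_or n.negOnePow with h | h
        · exact ⟨g, by simp [hg, h]⟩
        · exact ⟨-g, by simp [hg, h]⟩
    infer_instance

end Linear

end RelGlobalDim

/-! Say that `X` has degree `j` part when `M⟦j⟧` maps nontrivially to it; the heart is degree zero.
Serre duality gives Hom(s, s[m]) ≅ Hom(s[m], S s)^∨. As S s lies in T^b_c, its degrees are bounded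
above, whereas s[m] lives in degrees ≥ m, so orthogonality of the t-structure kills Hom(s, s[m]) for
large m (`exists_homZero_shift`). Once this bound holds on Add s, finite filtrations carry it to the
heart in both variables (`homZero_shift_of_hasFiniteFiltration`).

The difficulty is to pass from `s` to Add s in the target, since `s` need not be compact: a morphism
s → (∐ s)[m] has to factor through a finite subcoproduct (`exists_comp_shift_cofanTrunc`). Resolve
`s` by finite sums of the compact object `M`. If P → X is such a cover with fibre X', then Hom(P, (∐
s)[m]) = 0 for m > 0 reduces (X, m) to (X', m − 1), and at m = 0 compactness of P suffices. To
continue, Hom(M, X') must again be finite-dimensional. Long exact sequences control only Hom(X',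
s[i]); the filtrations by Add s turn finiteness of Hom(X', s) into finiteness of Hom(M, X')
(`finite_hom_of_siltingGE`). The initial finiteness of Hom(s, s[i]) is forced by applying Serre
duality twice (`SerreFunctor.finite_hom`). -/

namespace RelGlobalDim

/-! ### Coproducts and their finite truncations. -/

section Cofan

variable {C : Type u} [Category.{v} C] [Preadditive C] {J : Type*} {X : J → C} {c : Cofan X}

open Classical in
/-- The projections of a coproduct in a preadditive category. -/
noncomputable def cofanProj (hc : IsColimit c) (j : J) : c.pt ⟶ X j :=
  Cofan.IsColimit.desc hc fun i => if h : i = j then eqToHom (by rw [h]) else 0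

@[simp]
lemma inj_cofanProj_self (hc : IsColimit c) (j : J) : c.inj j ≫ cofanProj hc j = 𝟙 _ := by
  simp [cofanProj]

lemma inj_cofanProj_of_ne (hc : IsColimit c) {i j : J} (h : i ≠ j) :
    c.inj i ≫ cofanProj hc j = 0 := by
  simp [cofanProj, h]

/-- The idempotent endomorphism of a coproduct projecting it onto a finite subcoproduct. -/
noncomputable def cofanTrunc (hc : IsColimit c) (F : Finset J) : c.pt ⟶ c.pt :=
  ∑ j ∈ F, cofanProj hc j ≫ c.inj j

lemma inj_cofanTrunc_of_mem (hc : IsColimit c) {F : Finset J} {j : J} (hj : j ∈ F) :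
    c.inj j ≫ cofanTrunc hc F = c.inj j := by
  rw [cofanTrunc, Preadditive.comp_sum, Finset.sum_eq_single_of_mem j hj]
  · rw [← Category.assoc, inj_cofanProj_self, Category.id_comp]
  · intro i _ hi
    rw [← Category.assoc, inj_cofanProj_of_ne hc hi.symm, zero_comp]

lemma cofanTrunc_comp_of_subset (hc : IsColimit c) {F G : Finset J} (h : F ⊆ G) :
    cofanTrunc hc F ≫ cofanTrunc hc G = cofanTrunc hc F := by
  conv_lhs => rw [cofanTrunc]
  rw [Preadditive.sum_comp]
  refine Finset.sum_congr rfl fun j hj => ?_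
  rw [Category.assoc, inj_cofanTrunc_of_mem hc (h hj)]

lemma comp_cofanTrunc_of_subset (hc : IsColimit c) {F G : Finset J} (h : F ⊆ G) {N : C}
    {f : N ⟶ c.pt} (hf : f ≫ cofanTrunc hc F = f) : f ≫ cofanTrunc hc G = f := by
  rw [← hf, Category.assoc, cofanTrunc_comp_of_subset hc h]

/-- Morphisms fixed by a finite truncation form a subgroup. The quotient map by it vanishes on each
Hom(N, X j), hence on their coproduct Hom(N, c.pt). -/
lemma exists_comp_cofanTrunc (hc : IsColimit c) (N : C)
    [PreservesColimitsOfShape (Discrete J) (preadditiveCoyoneda.obj (Opposite.op N))]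
    (f : N ⟶ c.pt) : ∃ F : Finset J, f ≫ cofanTrunc hc F = f := by
  classical
  let S : AddSubgroup (N ⟶ c.pt) :=
    { carrier := {f | ∃ F : Finset J, f ≫ cofanTrunc hc F = f}
      zero_mem' := ⟨∅, by simp⟩
      add_mem' := by
        rintro f g ⟨F, hF⟩ ⟨G, hG⟩
        exact ⟨F ∪ G, by rw [Preadditive.add_comp,
          comp_cofanTrunc_of_subset hc Finset.subset_union_left hF,
          comp_cofanTrunc_of_subset hc Finset.subset_union_right hG]⟩
      neg_mem' := by
        rintro f ⟨F, hF⟩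
        exact ⟨F, by rw [Preadditive.neg_comp, hF]⟩ }
  let q : (preadditiveCoyoneda.obj (Opposite.op N)).obj c.pt ⟶
      AddCommGrpCat.of ((N ⟶ c.pt) ⧸ S) := AddCommGrpCat.ofHom (QuotientAddGroup.mk' S)
  have hq : q = 0 := by
    refine (isColimitOfPreserves (preadditiveCoyoneda.obj (Opposite.op N)) hc).hom_ext ?_
    rintro ⟨j⟩
    ext g
    refine (QuotientAddGroup.eq_zero_iff (N := S) _).2 ⟨{j}, ?_⟩
    have h := inj_cofanTrunc_of_mem hc (Finset.mem_singleton_self j)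
    exact (Category.assoc _ _ _).trans (congrArg (fun t => CategoryStruct.comp (X := N) g t) h)
  exact (QuotientAddGroup.eq_zero_iff (N := S) f).1 (congrArg (fun φ => φ.hom f) hq)

lemma eq_of_comp_cofanProj_eq_zero (hc : IsColimit c) {N : C}
    [PreservesColimitsOfShape (Discrete J) (preadditiveCoyoneda.obj (Opposite.op N))]
    (f : N ⟶ c.pt) (hf : ∀ j, f ≫ cofanProj hc j = 0) : f = 0 := by
  obtain ⟨F, hF⟩ := exists_comp_cofanTrunc hc N f
  rw [← hF, cofanTrunc, Preadditive.comp_sum]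
  exact Finset.sum_eq_zero fun j _ => by rw [← Category.assoc, hf j, zero_comp]

end Cofan

/-! ### Compact objects, vanishing of Hom, exact sequences of triangles. -/

section Compact

variable {C : Type u} [Category.{v} C] [Preadditive C]

lemma compactObjects.preserves {N : C} (hN : compactObjects C N) (J : Type*) [Small.{v} J] :
    PreservesColimitsOfShape (Discrete J) (preadditiveCoyoneda.obj (Opposite.op N)) := by
  have := hN (Shrink.{v} J)
  exact preservesColimitsOfShape_of_equiv (Discrete.equivalence (equivShrink.{v} J).symm) _

variable [HasShift C ℤ] [∀ n : ℤ, (shiftFunctor C n).Additive]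

lemma compactObjects.shift {N : C} (hN : compactObjects C N) (n : ℤ) :
    compactObjects C (N⟦n⟧) := by
  intro J
  have := hN J
  have : (shiftEquiv C n).functor.Additive := inferInstanceAs (shiftFunctor C n).Additive
  have e : shiftFunctor C (-n) ⋙ preadditiveCoyoneda.obj (Opposite.op N) ≅
      preadditiveCoyoneda.obj (Opposite.op (N⟦n⟧)) :=
    NatIso.ofComponents (fun X => AddEquiv.toAddCommGrpIso
      (((shiftEquiv C n).toAdjunction.homAddEquiv N X).symm)) (by
        intro X Y f
        ext g
        exact ((shiftEquiv C n).toAdjunction.homEquiv_naturality_right_symm g f))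
  exact preservesColimitsOfShape_of_natIso e

end Compact

section HomZero

variable {C : Type u} [Category.{v} C] [Preadditive C]

/-- There are no nonzero morphisms from `N` to `X`. -/
def HomZero (N X : C) : Prop := ∀ f : N ⟶ X, f = 0

lemma HomZero.of_iso {N N' X X' : C} (h : HomZero N X) (e : N ≅ N') (e' : X ≅ X') :
    HomZero N' X' := fun f => by
  have h' := h (e.hom ≫ f ≫ e'.inv)
  rw [← cancel_epi e.hom, ← cancel_mono e'.inv, Category.assoc, h']
  simp

lemma homZero_congr {N N' X X' : C} (e : N ≅ N') (e' : X ≅ X') :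
    HomZero N X ↔ HomZero N' X' :=
  ⟨fun h => h.of_iso e e', fun h => h.of_iso e.symm e'.symm⟩

lemma HomZero.coproduct {J : Type*} [Small.{v} J] {X : J → C} {c : Cofan X} (hc : IsColimit c)
    {N : C} (hN : compactObjects C N) (h : ∀ j, HomZero N (X j)) : HomZero N c.pt := fun f => by
  have := hN.preserves J
  exact eq_of_comp_cofanProj_eq_zero hc f fun j => h j _

variable [HasShift C ℤ] [∀ n : ℤ, (shiftFunctor C n).Additive]

lemma homZero_shift_iff (N X : C) (a : ℤ) : HomZero (N⟦a⟧) (X⟦a⟧) ↔ HomZero N X := by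
  constructor
  · intro h f
    apply (shiftFunctor C a).map_injective
    rw [h (f⟦a⟧'), Functor.map_zero]
  · intro h f
    obtain ⟨g, rfl⟩ := (shiftFunctor C a).map_surjective f
    rw [h g, Functor.map_zero]

lemma homZero_shift_right_iff (N X : C) (a : ℤ) : HomZero N (X⟦a⟧) ↔ HomZero (N⟦-a⟧) X := by
  rw [← homZero_shift_iff (N⟦-a⟧) X a]
  exact homZero_congr (shiftNegShift N a).symm (Iso.refl _)

lemma HomZero.shift_coproduct {J : Type*} [Small.{v} J] {X : J → C} {c : Cofan X}
    (hc : IsColimit c) {N : C} (hN : compactObjects C N) {a : ℤ}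
    (h : ∀ j, HomZero N ((X j)⟦a⟧)) : HomZero N (c.pt⟦a⟧) := by
  rw [homZero_shift_right_iff]
  exact .coproduct hc (hN.shift (-a)) fun j => (homZero_shift_right_iff _ _ _).1 (h j)

end HomZero

section DistTriang

variable {C : Type u} [Category.{v} C] [Preadditive C] [HasZeroObject C] [HasShift C ℤ]
  [∀ n : ℤ, (shiftFunctor C n).Additive] [Pretriangulated C]
  {X Y Z : C} {f : X ⟶ Y} {g : Y ⟶ Z} {h : Z ⟶ X⟦(1 : ℤ)⟧}

lemma dist_comp₁₂ (hT : Triangle.mk f g h ∈ distTriang C) : f ≫ g = 0 :=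
  comp_distTriang_mor_zero₁₂ _ hT

lemma dist_comp₂₃ (hT : Triangle.mk f g h ∈ distTriang C) : g ≫ h = 0 :=
  comp_distTriang_mor_zero₂₃ _ hT

lemma dist_comp₃₁ (hT : Triangle.mk f g h ∈ distTriang C) : h ≫ f⟦(1 : ℤ)⟧' = 0 :=
  comp_distTriang_mor_zero₃₁ _ hT

lemma dist_lift₂ (hT : Triangle.mk f g h ∈ distTriang C) {N : C} (u : N ⟶ Y) (hu : u ≫ g = 0) :
    ∃ v : N ⟶ X, v ≫ f = u :=
  (Triangle.coyoneda_exact₂ _ hT u hu).imp fun _ => Eq.symm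

lemma dist_lift₃ (hT : Triangle.mk f g h ∈ distTriang C) {N : C} (u : N ⟶ Z) (hu : u ≫ h = 0) :
    ∃ v : N ⟶ Y, v ≫ g = u :=
  (Triangle.coyoneda_exact₃ _ hT u hu).imp fun _ => Eq.symm

lemma dist_lift₁ (hT : Triangle.mk f g h ∈ distTriang C) {N : C} (u : N ⟶ X⟦(1 : ℤ)⟧)
    (hu : u ≫ f⟦(1 : ℤ)⟧' = 0) : ∃ v : N ⟶ Z, v ≫ h = u :=
  (Triangle.coyoneda_exact₁ _ hT u hu).imp fun _ => Eq.symm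

lemma dist_desc₂ (hT : Triangle.mk f g h ∈ distTriang C) {W : C} (u : Y ⟶ W) (hu : f ≫ u = 0) :
    ∃ v : Z ⟶ W, g ≫ v = u :=
  (Triangle.yoneda_exact₂ _ hT u hu).imp fun _ => Eq.symm

lemma dist_desc₃ (hT : Triangle.mk f g h ∈ distTriang C) {W : C} (u : Z ⟶ W) (hu : g ≫ u = 0) :
    ∃ v : X⟦(1 : ℤ)⟧ ⟶ W, h ≫ v = u :=
  (Triangle.yoneda_exact₃ _ hT u hu).imp fun _ => Eq.symm

end DistTriang

/-! ### Homotopy colimits and attaching cells. -/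

section Telescope

variable {C : Type u} [Category.{v} C]

/-- The composite `A n ⟶ A (n + m)` of the transition morphisms of a sequence. -/
def towerMap {A : ℕ → C} (t : ∀ n, A n ⟶ A (n + 1)) (n : ℕ) : ∀ m, A n ⟶ A (n + m)
  | 0 => 𝟙 _
  | m + 1 => towerMap t n m ≫ t (n + m)

variable {A : ℕ → C} (t : ∀ n, A n ⟶ A (n + 1)) {c : Cofan A} (hc : IsColimit c)

/-- The shift endomorphism of the coproduct of a sequence. -/
def telescopeShift : c.pt ⟶ c.pt :=
  Cofan.IsColimit.desc hc fun n => t n ≫ c.inj (n + 1)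

@[simp]
lemma inj_telescopeShift (n : ℕ) : c.inj n ≫ telescopeShift t hc = t n ≫ c.inj (n + 1) := by
  simp [telescopeShift]

variable [Preadditive C]

lemma telescopeShift_proj_zero : telescopeShift t hc ≫ cofanProj hc 0 = 0 := by
  refine Cofan.IsColimit.hom_ext hc _ _ fun n => ?_
  rw [← Category.assoc, inj_telescopeShift, Category.assoc,
    inj_cofanProj_of_ne hc (Nat.succ_ne_zero n), comp_zero, comp_zero]

lemma telescopeShift_proj_succ (n : ℕ) :
    telescopeShift t hc ≫ cofanProj hc (n + 1) = cofanProj hc n ≫ t n := by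
  refine Cofan.IsColimit.hom_ext hc _ _ fun m => ?_
  rw [← Category.assoc, inj_telescopeShift, Category.assoc, ← Category.assoc (c.inj m)]
  rcases eq_or_ne m n with rfl | h
  · simp
  · rw [inj_cofanProj_of_ne hc h, inj_cofanProj_of_ne hc (by omega), comp_zero, zero_comp]

lemma eq_zero_of_comp_id_sub_telescopeShift {N : C} (hN : compactObjects C N) (f : N ⟶ c.pt)
    (hf : f ≫ (𝟙 _ - telescopeShift t hc) = 0) : f = 0 := by
  have := hN.preserves ℕ
  have hf' : f = f ≫ telescopeShift t hc := by
    rwa [Preadditive.comp_sub, Category.comp_id, sub_eq_zero] at hf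
  refine eq_of_comp_cofanProj_eq_zero hc f fun n => ?_
  induction n with
  | zero => rw [hf', Category.assoc, telescopeShift_proj_zero, comp_zero]
  | succ n ih => rw [hf', Category.assoc, telescopeShift_proj_succ, ← Category.assoc, ih, zero_comp]

/-- Modulo the image of `𝟙 - telescopeShift`, a component in `A n` may be pushed along the tower
until it dies; by compactness there are only finitely many components. -/
lemma exists_eq_comp_id_sub_telescopeShift {N : C} (hN : compactObjects C N)
    (h : ∀ n (f : N ⟶ A n), ∃ m, f ≫ towerMap t n m = 0) (f : N ⟶ c.pt) :
    ∃ g : N ⟶ c.pt, f = g ≫ (𝟙 _ - telescopeShift t hc) := by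
  have := hN.preserves ℕ
  have key : ∀ n (f : N ⟶ A n) m, ∃ g : N ⟶ c.pt, f ≫ c.inj n =
      g ≫ (𝟙 _ - telescopeShift t hc) + (f ≫ towerMap t n m) ≫ c.inj (n + m) := by
    intro n f m
    induction m with
    | zero => exact ⟨0, by simp [towerMap]⟩
    | succ m ih =>
      obtain ⟨g, hg⟩ := ih
      refine ⟨g + (f ≫ towerMap t n m) ≫ c.inj (n + m), ?_⟩
      rw [hg, Preadditive.add_comp, add_assoc]
      congr 1
      have h₁ := inj_telescopeShift t hc (n + m)
      have h₂ : f ≫ towerMap t n (m + 1) = (f ≫ towerMap t n m) ≫ t (n + m) :=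
        (Category.assoc _ _ _).symm
      rw [h₂, Preadditive.comp_sub, Category.comp_id, Category.assoc _ _ (telescopeShift t hc), h₁,
        Category.assoc _ (t (n + m))]
      exact (sub_add_cancel _ _).symm
  obtain ⟨F, hF⟩ := exists_comp_cofanTrunc hc N f
  choose m hm using h
  choose g hg using key
  refine ⟨∑ j ∈ F, g j (f ≫ cofanProj hc j) (m j (f ≫ cofanProj hc j)), ?_⟩
  conv_lhs => rw [← hF, cofanTrunc, Preadditive.comp_sum]
  rw [Preadditive.sum_comp]
  refine Finset.sum_congr rfl fun j _ => ?_
  rw [← Category.assoc, hg j _ (m j (f ≫ cofanProj hc j)), hm, zero_comp, add_zero]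

end Telescope

section Cones

variable {C : Type u} [Category.{v} C] [Preadditive C] [HasZeroObject C] [HasShift C ℤ]
  [∀ n : ℤ, (shiftFunctor C n).Additive] [Pretriangulated C]

/-- Homotopy colimits of sequences, and their behaviour with respect to compact objects. -/
lemma exists_hocolim (hC : HasCoproducts.{v} C) {A : ℕ → C} (t : ∀ n, A n ⟶ A (n + 1)) :
    ∃ (Y : C) (j : A 0 ⟶ Y),
      (∀ (Z : C) (φ : ∀ n, A n ⟶ Z), (∀ n, t n ≫ φ (n + 1) = φ n) → ∃ ψ, j ≫ ψ = φ 0) ∧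
      (∀ N, compactObjects C N → (∀ n (f : N ⟶ A n), ∃ m, f ≫ towerMap t n m = 0) →
        HomZero N Y) ∧
      (∀ N, compactObjects C N → (∀ n (f : N ⟶ A n), f ≫ t n = 0 → f = 0) →
        ∀ h : N ⟶ A 0, h ≫ j = 0 → h = 0) ∧
      (∀ N, compactObjects C N → (∀ n (f : N ⟶ A (n + 1)), ∃ g, g ≫ t n = f) →
        ∀ f : N ⟶ Y, ∃ g, g ≫ j = f) := by
  have : HasColimitsOfShape (Discrete ℕ) C := by
    have := hC (ULift.{v} ℕ)
    exact hasColimitsOfShape_of_equivalence (Discrete.equivalence Equiv.ulift.{v})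
  let c : Cofan A := Cofan.mk (∐ A) (Sigma.ι A)
  let hc : IsColimit c := coproductIsCoproduct A
  obtain ⟨Y, g, δ, hT⟩ := distinguished_cocone_triangle (𝟙 c.pt - telescopeShift t hc)
  have hg (n : ℕ) : t n ≫ c.inj (n + 1) ≫ g = c.inj n ≫ g := by
    have := congrArg (c.inj n ≫ ·) (dist_comp₁₂ hT)
    simp only [← Category.assoc, Preadditive.comp_sub, Category.comp_id, inj_telescopeShift,
      Preadditive.sub_comp, comp_zero, sub_eq_zero] at this
    rw [this, Category.assoc]
  -- `𝟙 - telescopeShift` is injective on morphisms from the compact object `N⟦-1⟧`, so the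
  -- connecting map vanishes and every `N ⟶ Y` lifts to the coproduct.
  have hδ {N : C} (hN : compactObjects C N) (f : N ⟶ Y) : f ≫ δ = 0 := by
    have h0 : (f ≫ δ) ≫ (𝟙 c.pt - telescopeShift t hc)⟦(1 : ℤ)⟧' = 0 := by
      rw [Category.assoc, dist_comp₃₁ hT, comp_zero]
    obtain ⟨f', hf'⟩ := (shiftFunctor C (1 : ℤ)).map_surjective
      ((shiftNegShift N (1 : ℤ)).hom ≫ f ≫ δ)
    have hf0 : f' = 0 := by
      refine eq_zero_of_comp_id_sub_telescopeShift t hc (hN.shift (-1)) f' ?_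
      apply (shiftFunctor C (1 : ℤ)).map_injective
      rw [Functor.map_comp, hf', Category.assoc, h0, comp_zero, Functor.map_zero]
    rw [hf0, Functor.map_zero] at hf'
    rw [← cancel_epi (shiftNegShift N (1 : ℤ)).hom, ← hf', comp_zero]
  refine ⟨Y, c.inj 0 ≫ g, ?_, ?_, ?_, ?_⟩
  · intro Z φ hφ
    obtain ⟨ψ, hψ⟩ := dist_desc₂ hT (Cofan.IsColimit.desc hc φ) (by
      refine Cofan.IsColimit.hom_ext hc _ _ fun n => ?_
      rw [← Category.assoc, Preadditive.comp_sub, Category.comp_id, inj_telescopeShift,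
        Preadditive.sub_comp, Category.assoc, Cofan.IsColimit.fac, Cofan.IsColimit.fac, hφ,
        sub_self, comp_zero])
    exact ⟨ψ, by rw [Category.assoc, hψ, Cofan.IsColimit.fac]⟩
  · intro N hN h f
    obtain ⟨f₁, hf₁⟩ := dist_lift₃ hT f (hδ hN f)
    obtain ⟨f₂, hf₂⟩ := exists_eq_comp_id_sub_telescopeShift t hc hN h f₁
    rw [← hf₁, hf₂, Category.assoc, dist_comp₁₂ hT, comp_zero]
  · intro N hN ht h hj
    have := hN.preserves ℕ
    -- The components of `k` start with `h` and are carried to one another by `t`. One of them is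
    -- zero because `k` has finite support; injectivity of the transitions brings this back to `h`.
    obtain ⟨k, hk⟩ := dist_lift₂ hT (h ≫ c.inj 0) ((Category.assoc _ _ _).trans hj)
    have hk0 : k ≫ cofanProj hc 0 = h := by
      have := congrArg (· ≫ cofanProj hc 0) hk
      simp only [Category.assoc, Preadditive.sub_comp, inj_cofanProj_self] at this
      simpa [telescopeShift_proj_zero] using this
    have hks (n : ℕ) : k ≫ cofanProj hc (n + 1) = (k ≫ cofanProj hc n) ≫ t n := by
      have := congrArg (· ≫ cofanProj hc (n + 1)) hk
      simp only [Category.assoc, Preadditive.sub_comp,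
        telescopeShift_proj_succ, inj_cofanProj_of_ne hc (Nat.succ_ne_zero n).symm] at this
      rw [Category.assoc]
      simp only [comp_zero, Preadditive.comp_sub, Category.id_comp] at this
      exact sub_eq_zero.1 this
    obtain ⟨F, hF⟩ := exists_comp_cofanTrunc hc N k
    obtain ⟨n, hn⟩ : ∃ n, k ≫ cofanProj hc n = 0 := by
      obtain ⟨n, hn⟩ := Infinite.exists_notMem_finset F
      refine ⟨n, ?_⟩
      rw [← hF, cofanTrunc, Preadditive.comp_sum, Preadditive.sum_comp]
      refine Finset.sum_eq_zero fun i hi => ?_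
      rw [Category.assoc, Category.assoc, inj_cofanProj_of_ne hc (ne_of_mem_of_not_mem hi hn),
        comp_zero, comp_zero]
    rw [← hk0]
    induction n with
    | zero => exact hn
    | succ n ih => exact ih (ht n _ ((hks n).symm.trans hn))
  · intro N hN ht f
    have := hN.preserves ℕ
    have key : ∀ n (u : N ⟶ A n), ∃ h : N ⟶ A 0, h ≫ c.inj 0 ≫ g = u ≫ c.inj n ≫ g := by
      intro n
      induction n with
      | zero => exact fun u => ⟨u, rfl⟩
      | succ n ih =>
        intro u
        obtain ⟨u', rfl⟩ := ht n u
        obtain ⟨h, hh⟩ := ih u'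
        exact ⟨h, by rw [hh, Category.assoc, hg]⟩
    choose r hr using key
    obtain ⟨f₁, rfl⟩ := dist_lift₃ hT f (hδ hN f)
    obtain ⟨F, hF⟩ := exists_comp_cofanTrunc hc N f₁
    refine ⟨∑ i ∈ F, r i (f₁ ≫ cofanProj hc i), ?_⟩
    conv_rhs => rw [← hF, cofanTrunc, Preadditive.comp_sum, Preadditive.sum_comp]
    rw [Preadditive.sum_comp]
    refine Finset.sum_congr rfl fun i _ => ?_
    rw [hr]
    simp only [Category.assoc]

/-- Attaching cells: the cone of the universal morphism to `X` from a coproduct of objects `G i`. -/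
lemma exists_attach (hC : HasCoproducts.{v} C) {I : Type*} [Small.{v} I] (G : I → C) (X : C) :
    ∃ (X' : C) (p : X ⟶ X'), (∀ i (f : G i ⟶ X), f ≫ p = 0) ∧
      (∀ (Z : C) (u : X ⟶ Z), (∀ i, HomZero (G i) Z) → ∃ u', p ≫ u' = u) ∧
      (∀ N, compactObjects C N → (∀ i, HomZero N (G i)) → ∀ f : N ⟶ X, f ≫ p = 0 → f = 0) ∧
      (∀ N, compactObjects C N → (∀ i, HomZero N ((G i)⟦(1 : ℤ)⟧)) →
        ∀ f : N ⟶ X', ∃ g, g ≫ p = f) := by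
  let J := Σ i : I, (G i ⟶ X)
  have : HasColimitsOfShape (Discrete J) C := by
    have := hC (Shrink.{v} J)
    exact hasColimitsOfShape_of_equivalence (Discrete.equivalence (equivShrink.{v} J).symm)
  let A : J → C := fun a => G a.1
  let c : Cofan A := Cofan.mk (∐ A) (Sigma.ι A)
  let hc : IsColimit c := coproductIsCoproduct A
  let φ : c.pt ⟶ X := Cofan.IsColimit.desc hc fun a => a.2
  obtain ⟨X', p, δ, hT⟩ := distinguished_cocone_triangle φ
  refine ⟨X', p, fun i f => ?_, fun Z u hu => ?_, fun N hN h f hf => ?_, fun N hN h f => ?_⟩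
  · have h0 : c.inj (⟨i, f⟩ : J) ≫ φ = f := Cofan.IsColimit.fac hc (fun a : J => a.2) ⟨i, f⟩
    rw [← h0, Category.assoc, dist_comp₁₂ hT, comp_zero]
  · exact dist_desc₂ hT u
      (Cofan.IsColimit.hom_ext hc _ _ fun a => (hu a.1 _).trans (hu a.1 _).symm)
  · obtain ⟨g, rfl⟩ := dist_lift₂ hT f hf
    have : g = 0 := HomZero.coproduct hc hN (fun a => h a.1) g
    rw [this, zero_comp]
  · exact dist_lift₃ hT f (HomZero.shift_coproduct hc hN (fun a => h a.1) _)

end Cones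

/-! ### The t-structure of a compact silting object. -/

section Silting

variable {C : Type u} [Category.{v} C] [Preadditive C] [HasShift C ℤ]

/-- There are no nonzero morphisms from the shifts `M⟦j⟧`, `j < a`. -/
def SiltingGE (M : C) (a : ℤ) (X : C) : Prop := ∀ j < a, HomZero (M⟦j⟧) X

/-- There are no nonzero morphisms from the shifts `M⟦j⟧`, `a ≤ j`. -/
def SiltingLT (M : C) (a : ℤ) (X : C) : Prop := ∀ j, a ≤ j → HomZero (M⟦j⟧) X

lemma SiltingGE.of_le {M : C} {a b : ℤ} {X : C} (h : SiltingGE M b X) (hab : a ≤ b) :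
    SiltingGE M a X := fun j hj => h j (by omega)

lemma SiltingLT.of_le {M : C} {a b : ℤ} {X : C} (h : SiltingLT M a X) (hab : a ≤ b) :
    SiltingLT M b X := fun j hj => h j (by omega)

variable [∀ n : ℤ, (shiftFunctor C n).Additive]

lemma homZero_shift_shift_iff_sub (M X : C) (j n : ℤ) :
    HomZero (M⟦j⟧) (X⟦n⟧) ↔ HomZero (M⟦j - n⟧) X := by
  rw [homZero_shift_right_iff]
  exact homZero_congr ((shiftFunctorAdd' C j (-n) (j - n) (by omega)).symm.app M) (Iso.refl _)

lemma SiltingGE.shift {M : C} {a : ℤ} {X : C} (h : SiltingGE M a X) (n b : ℤ) (hb : a + n = b) :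
    SiltingGE M b (X⟦n⟧) := fun j hj =>
  (homZero_shift_shift_iff_sub _ _ _ _).2 (h _ (by omega))

lemma SiltingLT.shift {M : C} {a : ℤ} {X : C} (h : SiltingLT M a X) (n b : ℤ) (hb : a + n = b) :
    SiltingLT M b (X⟦n⟧) := fun j hj =>
  (homZero_shift_shift_iff_sub _ _ _ _).2 (h _ (by omega))

lemma homZero_shift_iff_neg (M X : C) (i : ℤ) : HomZero (M⟦i⟧) X ↔ HomZero M (X⟦-i⟧) := by
  rw [homZero_shift_right_iff, neg_neg]

lemma siltingHeart_iff {M X : C} : siltingHeart M X ↔ SiltingGE M 0 X ∧ SiltingLT M 1 X := by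
  constructor
  · exact fun h => ⟨fun j hj => (homZero_shift_iff_neg _ _ _).2 (h (-j) (by omega)),
      fun j hj => (homZero_shift_iff_neg _ _ _).2 (h (-j) (by omega))⟩
  · rintro ⟨h₁, h₂⟩ i hi
    rcases lt_or_gt_of_ne hi with h | h
    · exact (homZero_shift_right_iff _ _ _).2 (h₂ _ (by omega))
    · exact (homZero_shift_right_iff _ _ _).2 (h₁ _ (by omega))

end Silting

section TStructure

variable {C : Type u} [Category.{v} C] [Preadditive C] [HasZeroObject C] [HasShift C ℤ]
  [∀ n : ℤ, (shiftFunctor C n).Additive] [Pretriangulated C]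

lemma IsCompactSilting.siltingGE {M : C} (hM : IsCompactSilting M) (j : ℤ) :
    SiltingGE M j (M⟦j⟧) := fun i hi => by
  rw [homZero_shift_shift_iff_sub, homZero_shift_iff_neg]
  exact hM.hom_shift_eq_zero _ (by omega)

lemma HomZero.mid {X Y Z : C} {f : X ⟶ Y} {g : Y ⟶ Z} {h : Z ⟶ X⟦(1 : ℤ)⟧}
    (hT : Triangle.mk f g h ∈ distTriang C) {N : C} (hX : HomZero N X) (hZ : HomZero N Z) :
    HomZero N Y := fun u => by
  obtain ⟨v, rfl⟩ := dist_lift₂ hT u (hZ _)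
  rw [hX v, zero_comp]

lemma HomZero.third {X Y Z : C} {f : X ⟶ Y} {g : Y ⟶ Z} {h : Z ⟶ X⟦(1 : ℤ)⟧}
    (hT : Triangle.mk f g h ∈ distTriang C) {N : C} (hX : HomZero N (X⟦(1 : ℤ)⟧))
    (hY : HomZero N Y) : HomZero N Z :=
  HomZero.mid (rot_of_distTriang _ hT) hY hX

lemma HomZero.first {X Y Z : C} {f : X ⟶ Y} {g : Y ⟶ Z} {h : Z ⟶ X⟦(1 : ℤ)⟧}
    (hT : Triangle.mk f g h ∈ distTriang C) {N : C} (hY : HomZero N Y)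
    (hZ : HomZero (N⟦(1 : ℤ)⟧) Z) : HomZero N X := by
  rw [← homZero_shift_iff _ _ 1]
  exact HomZero.third (rot_of_distTriang _ hT) ((homZero_shift_iff _ _ 1).2 hY) hZ

/-- The left orthogonal of all shifts of `Y` is thick and contains `M`, hence contains every compact
object, in particular the generators. -/
lemma isZero_of_forall_homZero (hC : IsCompactlyGenerated C) {M : C} (hM : IsCompactSilting M)
    {Y : C} (h : ∀ j : ℤ, HomZero (M⟦j⟧) Y) : IsZero Y := by
  let Q : ObjectProperty C := ((ObjectProperty.singleton Y).shiftClosure ℤ).leftOrthogonal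
  have : Q.IsStableUnderRetracts := ⟨fun {A B} r hB W f hW => by
    have := hB (r.r ≫ f) hW
    rw [← Category.id_comp f, ← r.retract, Category.assoc, this, comp_zero]⟩
  have hle : (ObjectProperty.singleton M).triangEnvelope ≤ Q := by
    rw [ObjectProperty.triangEnvelope_le_iff, ObjectProperty.singleton_le_iff]
    intro W f hW
    rw [ObjectProperty.prop_shiftClosure_iff] at hW
    obtain ⟨Z, n, e, hZ⟩ := hW
    obtain rfl := (ObjectProperty.singleton_iff _ _).1 hZ
    exact ((homZero_shift_right_iff _ _ _).2 (h (-n))).of_iso (Iso.refl _) e.symm f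
  rw [hM.thick_eq] at hle
  obtain ⟨ι, G, hG, hG'⟩ := hC.exists_generators
  refine hG' Y fun i n f => hle _ (hG i) f ?_
  exact ⟨Y, n, Iso.refl _, (ObjectProperty.singleton_iff _ _).2 rfl⟩

/-- Orthogonality for the t-structure attached to a compact silting object. -/
lemma homZero_of_siltingGE_of_siltingLT (hC : IsCompactlyGenerated C) {M : C}
    (hM : IsCompactSilting M) {a : ℤ} {X Z : C} (hX : SiltingGE M a X) (hZ : SiltingLT M a Z) :
    HomZero X Z := by
  intro u
  -- Kill the degrees `a`, `a + 1`, … of `X` one after the other. By the silting condition,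
  -- attaching cells `M⟦a + n⟧` creates nothing in degrees ≤ `a + n`, so the colimit is zero; yet
  -- `u` extends over each stage because `Z` receives nothing from the cells.
  choose X' p h₁ h₂ h₃ h₄ using fun (b : ℤ) (X : C) =>
    exists_attach hC.hasCoproducts (fun _ : Unit => M⟦b⟧) X
  let A : ℕ → C := Nat.rec X fun n Y => X' (a + n) Y
  let t (n : ℕ) : A n ⟶ A (n + 1) := p (a + n) (A n)
  have hA (n : ℕ) : SiltingGE M (a + n) (A n) := by
    induction n with
    | zero => exact hX.of_le (by simp)
    | succ n ih =>
      intro j hj f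
      push_cast at hj
      obtain ⟨g, rfl⟩ := h₄ (a + n) (A n) (M⟦j⟧) (hM.compact.shift j)
        (fun _ => (hM.siltingGE (a + n)).shift 1 _ rfl j (by omega)) f
      rcases (show j ≤ a + n by omega).eq_or_lt with rfl | hj'
      · exact h₁ (a + n) (A n) () g
      · rw [ih j hj' g, zero_comp]
  choose e he using h₂
  let φ : ∀ n, A n ⟶ Z := Nat.rec u fun n ψ =>
    e (a + n) (A n) Z ψ fun _ => hZ _ (by omega)
  obtain ⟨Y, j, hY₁, hY₂, -⟩ := exists_hocolim hC.hasCoproducts t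
  obtain ⟨ψ, hψ⟩ := hY₁ Z φ fun n => he (a + n) (A n) Z (φ n) fun _ => hZ _ (by omega)
  have hY : IsZero Y := isZero_of_forall_homZero hC hM fun i =>
    hY₂ _ (hM.compact.shift i) fun n f => ⟨(i - a).toNat + 1, hA (n + ((i - a).toNat + 1)) i (by omega) _⟩
  change j ≫ ψ = u at hψ
  rw [← hψ, hY.eq_zero_of_src ψ, comp_zero]

/-- Truncation for the t-structure attached to a compact silting object. -/
lemma exists_truncation (hC : IsCompactlyGenerated C) {M : C}
    (hM : IsCompactSilting M) (a : ℤ) (X : C) :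
    ∃ (U V : C) (f : U ⟶ X) (g : X ⟶ V) (h : V ⟶ U⟦(1 : ℤ)⟧),
      Triangle.mk f g h ∈ distTriang C ∧ SiltingGE M a U ∧ SiltingLT M a V := by
  -- Attach cells of all degrees ≥ `a` at every stage: the colimit `V` has no such degrees left. For
  -- `j < a` the silting condition makes attachment injective on morphisms from `M⟦j⟧` and
  -- surjective on those from `M⟦j + 1⟧`, so the fibre `U` has nothing in degree `j`.
  choose X' p h₁ h₂ h₃ h₄ using fun (X : C) =>
    exists_attach hC.hasCoproducts (fun n : ℕ => M⟦a + (n : ℤ)⟧) X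
  let A : ℕ → C := Nat.rec X fun _ Y => X' Y
  let t (n : ℕ) : A n ⟶ A (n + 1) := p (A n)
  obtain ⟨V, g, -, hV₂, hV₃, hV₄⟩ := exists_hocolim hC.hasCoproducts t
  change X ⟶ V at g
  obtain ⟨U, f, h, hT⟩ := distinguished_cocone_triangle₁ g
  have hV : SiltingLT M a V := fun j hj => hV₂ _ (hM.compact.shift j) fun n f => ⟨1, by
    obtain ⟨i, rfl⟩ : ∃ i : ℕ, a + i = j := ⟨(j - a).toNat, by omega⟩
    have := h₁ (A n) i f
    rw [towerMap, towerMap, Category.id_comp]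
    exact this⟩
  refine ⟨U, V, f, g, h, hT, fun j hj u => ?_, hV⟩
  have hu : u ≫ f = 0 := hV₃ _ (hM.compact.shift j)
    (fun n => h₃ (A n) _ (hM.compact.shift j) fun i => hM.siltingGE _ _ (by omega)) _ (by
      rw [Category.assoc, dist_comp₁₂ hT, comp_zero])
  apply (shiftFunctor C (1 : ℤ)).map_injective
  obtain ⟨w, hw⟩ := dist_lift₁ hT (u⟦(1 : ℤ)⟧') (by rw [← Functor.map_comp, hu, Functor.map_zero])
  obtain ⟨k, rfl⟩ : ∃ k, k ≫ g = w := by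
    rcases (show j + 1 ≤ a by omega).eq_or_lt with h' | h'
    · have hz : HomZero (M⟦j⟧⟦(1 : ℤ)⟧) V :=
        (hV (j + 1) h'.ge).of_iso ((shiftFunctorAdd C j 1).app M) (Iso.refl _)
      exact ⟨0, by rw [hz w, zero_comp]⟩
    · refine hV₄ _ ((hM.compact.shift j).shift 1) (fun n => ?_) w
      refine h₄ (A n) _ ((hM.compact.shift j).shift 1) fun i => ?_
      rw [homZero_shift_iff]
      exact hM.siltingGE _ _ (by omega)
  rw [← hw, Category.assoc, dist_comp₂₃ hT, comp_zero, Functor.map_zero]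

end TStructure

lemma addClosure.of_iso {C : Type u} [Category.{v} C] {s X Y : C} (h : addClosure s X) (e : X ≅ Y) : addClosure s Y := by
  obtain ⟨J, c, hc, ⟨r⟩⟩ := h
  exact ⟨J, c, hc, ⟨(Retract.ofIso e.symm).trans r⟩⟩

/-! ### Short exact sequences and filtrations in the heart. -/

section Heart

variable {C : Type u} [Category.{v} C] [Preadditive C] [HasZeroObject C] [HasShift C ℤ]
  [∀ n : ℤ, (shiftFunctor C n).Additive] [Pretriangulated C]

lemma dist_desc₁ {X Y Z : C} {f : X ⟶ Y} {g : Y ⟶ Z} {h : Z ⟶ X⟦(1 : ℤ)⟧}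
    (hT : Triangle.mk f g h ∈ distTriang C) {W : C} (u : X ⟶ W) (hu : h ≫ u⟦(1 : ℤ)⟧' = 0) :
    ∃ v : Y ⟶ W, f ≫ v = u := by
  obtain ⟨v, hv⟩ := dist_desc₃ (rot_of_distTriang _ hT) (u⟦(1 : ℤ)⟧') hu
  change Y⟦(1 : ℤ)⟧ ⟶ W⟦(1 : ℤ)⟧ at v
  obtain ⟨w, rfl⟩ := (shiftFunctor C (1 : ℤ)).map_surjective v
  refine ⟨-w, (shiftFunctor C (1 : ℤ)).map_injective ?_⟩
  refine Eq.trans ?_ hv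
  rw [Functor.map_comp, Functor.map_neg, Preadditive.comp_neg]
  exact (Preadditive.neg_comp _ _).symm

variable {M : C}

/-- A short exact sequence in the heart comes from a distinguished triangle. -/
lemma exists_dist_of_mono_of_isColimit (hC : IsCompactlyGenerated C) (hM : IsCompactSilting M)
    {X Y Q : (siltingHeart M).FullSubcategory} (i : X ⟶ Y) [Mono i] (p : Y ⟶ Q) (w : i ≫ p = 0)
    (hp : IsColimit (CokernelCofork.ofπ p w)) :
    ∃ (W : C) (g : Y.obj ⟶ W) (h : W ⟶ X.obj⟦(1 : ℤ)⟧),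
      Triangle.mk i.hom g h ∈ distTriang C ∧ Nonempty (W ≅ Q.obj) := by
  obtain ⟨hX₀, hX₁⟩ := siltingHeart_iff.1 X.property
  obtain ⟨hY₀, hY₁⟩ := siltingHeart_iff.1 Y.property
  obtain ⟨hQ₀, hQ₁⟩ := siltingHeart_iff.1 Q.property
  obtain ⟨W, g, h, hT⟩ := distinguished_cocone_triangle i.hom
  have hW₀ : SiltingGE M 0 W := fun j hj =>
    HomZero.third hT (hX₀.shift 1 1 rfl j (by omega)) (hY₀ j hj)
  have hW₂ : SiltingLT M 2 W := fun j hj =>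
    HomZero.third hT (hX₁.shift 1 2 rfl j (by omega)) (hY₁ j (by omega))
  -- The cone has degrees 0 and 1 only. Its degree 1 part, shifted by −1, is an object of the heart
  -- whose map to `X` is killed by the monomorphism `i`, hence is zero.
  have hW₁ : SiltingLT M 1 W := by
    obtain ⟨U, V, a, b, d, hT', hU, hV⟩ := exists_truncation hC hM 1 W
    have hU₂ : SiltingLT M 2 U := fun j hj => HomZero.first hT' (hW₂ j hj)
      ((hV (j + 1) (by omega)).of_iso ((shiftFunctorAdd C j 1).app M) (Iso.refl _))
    have ha : a ≫ h = 0 := by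
      let K : (siltingHeart M).FullSubcategory := ⟨U⟦(-1 : ℤ)⟧, siltingHeart_iff.2
        ⟨hU.shift (-1) 0 rfl, hU₂.shift (-1) 1 rfl⟩⟩
      obtain ⟨r, hr⟩ := (shiftFunctor C (1 : ℤ)).map_surjective
        ((shiftNegShift U (1 : ℤ)).hom ≫ a ≫ h)
      have hr0 : r ≫ i.hom = 0 := by
        apply (shiftFunctor C (1 : ℤ)).map_injective
        rw [Functor.map_comp, hr, Functor.map_zero, Category.assoc, Category.assoc,
          dist_comp₃₁ hT, comp_zero, comp_zero]
      let r' : K ⟶ X := ObjectProperty.homMk r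
      have hr' : r' = 0 := by
        rw [← cancel_mono i, zero_comp]
        ext
        exact hr0
      have hr'' : r = 0 := congrArg (fun t => t.hom) hr'
      rw [hr'', Functor.map_zero] at hr
      rw [← cancel_epi (shiftNegShift U (1 : ℤ)).hom, ← hr, comp_zero]
    intro j hj f
    obtain ⟨f, rfl⟩ := dist_lift₂ hT' f (hV j hj _)
    obtain ⟨f', hf'⟩ := dist_lift₃ hT (f ≫ a) (by rw [Category.assoc, ha, comp_zero])
    rw [← hf', hY₁ j hj f', zero_comp]
  refine ⟨W, g, h, hT, ?_⟩
  -- This makes factorizations through `g` unique, so the cone is a cokernel of `i` in the heart.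
  have hXW : HomZero (X.obj⟦(1 : ℤ)⟧) W :=
    homZero_of_siltingGE_of_siltingLT hC hM (hX₀.shift 1 1 rfl) hW₁
  let W' : (siltingHeart M).FullSubcategory := ⟨W, siltingHeart_iff.2 ⟨hW₀, hW₁⟩⟩
  let g' : Y ⟶ W' := ObjectProperty.homMk g
  obtain ⟨α, hα⟩ := dist_desc₂ hT p.hom (congrArg (fun t => t.hom) w)
  obtain ⟨β, hβ⟩ := CokernelCofork.IsColimit.desc' hp g' (by
    ext
    exact dist_comp₁₂ hT)
  change p ≫ β = g' at hβ
  have hβ' : p.hom ≫ β.hom = g := congrArg (fun t => t.hom) hβ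
  refine ⟨⟨α, β.hom, ?_, ?_⟩⟩
  · rw [← sub_eq_zero]
    obtain ⟨v, hv⟩ := dist_desc₃ hT (α ≫ β.hom - 𝟙 W) (by
      rw [Preadditive.comp_sub, ← Category.assoc, hα, hβ', Category.comp_id, sub_self])
    rw [← hv, hXW v, comp_zero]
  · let α' : W' ⟶ Q := ObjectProperty.homMk α
    have : β ≫ α' = 𝟙 Q := by
      refine Cofork.IsColimit.hom_ext hp ?_
      change p ≫ β ≫ α' = p ≫ 𝟙 Q
      rw [← Category.assoc, hβ, Category.comp_id]
      ext
      exact hα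
    exact congrArg (fun t => t.hom) this

/-- Induction along finite filtrations in the heart. -/
lemma HasFiniteFiltration.induction (hC : IsCompactlyGenerated C) (hM : IsCompactSilting M)
    {s : C} (P : C → Prop) (hiso : ∀ {X Y : C}, (X ≅ Y) → P X → P Y) (hzero : ∀ X, IsZero X → P X)
    (hext : ∀ {X Y Z : C} (f : X ⟶ Y) (g : Y ⟶ Z) (h : Z ⟶ X⟦(1 : ℤ)⟧),
      Triangle.mk f g h ∈ distTriang C → siltingHeart M X → siltingHeart M Z → addClosure s Z →
        P X → P Y)
    {x : (siltingHeart M).FullSubcategory}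
    (hx : HasFiniteFiltration (siltingHeart M) (addClosure s) x) : P x.obj := by
  obtain ⟨n, F, i, h₀, ⟨e⟩, hF⟩ := hx
  have key : ∀ j ≤ n, P (F j).obj := by
    intro j hj
    induction j with
    | zero =>
      refine hzero _ ((IsZero.iff_id_eq_zero _).2 ?_)
      exact congrArg (fun t => t.hom) ((IsZero.iff_id_eq_zero _).1 h₀)
    | succ j ih =>
      obtain ⟨hmono, Q, p, hp, ⟨hcolim⟩, hQ⟩ := hF j (by omega)
      obtain ⟨W, g, h, hT, ⟨e⟩⟩ := exists_dist_of_mono_of_isColimit hC hM (i j) p hp hcolim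
      obtain ⟨h₀, h₁⟩ := siltingHeart_iff.1 Q.property
      refine hext _ g h hT (F j).property ?_ (addClosure.of_iso hQ e.symm) (ih (by omega))
      exact siltingHeart_iff.2 ⟨fun j hj => (h₀ j hj).of_iso (Iso.refl _) e.symm,
        fun j hj => (h₁ j hj).of_iso (Iso.refl _) e.symm⟩
  exact hiso ((siltingHeart M).ι.mapIso e) (key n le_rfl)

end Heart

/-! ### Finite-dimensionality of Hom spaces. -/

section Finite

variable (k : Type w) [Field k]

lemma finite_of_ker_le_range {A B D : Type*} [AddCommGroup A] [Module k A] [AddCommGroup B]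
    [Module k B] [AddCommGroup D] [Module k D] [Module.Finite k A] [Module.Finite k D]
    (f : A →ₗ[k] B) (g : B →ₗ[k] D) (h : ∀ b, g b = 0 → ∃ a, f a = b) : Module.Finite k B := by
  have hle : LinearMap.ker g ≤ LinearMap.range f := fun b hb => h b hb
  have : Module.Finite k (LinearMap.ker g) :=
    Module.Finite.of_injective (Submodule.inclusion hle) (Submodule.inclusion_injective hle)
  refine ⟨Submodule.fg_of_fg_map_of_fg_inf_ker g (IsNoetherian.noetherian _) ?_⟩
  rw [top_inf_eq]
  exact Module.Finite.iff_fg.1 this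

variable {C : Type u} [Category.{v} C] [Preadditive C] [Linear k C]

lemma finite_hom_of_iso {X Y X' Y' : C} (e : X ≅ X') (e' : Y ≅ Y') [Module.Finite k (X ⟶ Y)] :
    Module.Finite k (X' ⟶ Y') :=
  Module.Finite.equiv (Linear.homCongr k e e')

lemma HomZero.finite {X Y : C} (h : HomZero X Y) : Module.Finite k (X ⟶ Y) :=
  have : Subsingleton (X ⟶ Y) := ⟨fun f g => (h f).trans (h g).symm⟩
  inferInstance

/-- A retract `Z` of a coproduct of copies of `s` with `Hom(Z, s)` finite-dimensional receives
finite-dimensional spaces of morphisms from compact objects. -/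
lemma finite_hom_of_retract {s N Z : C} (hN : compactObjects C N) {J : Type v}
    {c : Cofan (fun _ : J => s)} (hc : IsColimit c) (r : Retract Z c.pt)
    [Module.Finite k (Z ⟶ s)] [Module.Finite k (N ⟶ s)] : Module.Finite k (N ⟶ Z) := by
  have := hN.preserves J
  -- Composition embeds Hom(N, Z) into the linear maps Hom(Z, s) → Hom(N, s): as `N` is compact, the
  -- projections of the coproduct detect its morphisms.
  refine Module.Finite.of_injective (Linear.comp (S := k) N Z s) ?_
  rw [← LinearMap.ker_eq_bot, LinearMap.ker_eq_bot']
  intro u hu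
  have : u ≫ r.i = 0 := eq_of_comp_cofanProj_eq_zero hc _ fun j => by
    rw [Category.assoc]
    exact LinearMap.congr_fun hu (r.i ≫ cofanProj hc j)
  rw [← Category.comp_id u, ← r.retract, ← Category.assoc, this, zero_comp]

/-- The condition `hF` exhibits `Z` as a retract of a finite sum of copies of `s`. -/
lemma finite_hom_of_retract_of_comp_cofanTrunc {s W Z : C} {J : Type*}
    {c : Cofan (fun _ : J => s)} (hc : IsColimit c) (r : Retract Z c.pt) {F : Finset J}
    (hF : r.i ≫ cofanTrunc hc F = r.i) [Module.Finite k (s ⟶ W)] : Module.Finite k (Z ⟶ W) := by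
  refine Module.Finite.of_injective
    (LinearMap.pi fun j : F => Linear.leftComp k W (c.inj j.1 ≫ r.r)) ?_
  rw [← LinearMap.ker_eq_bot, LinearMap.ker_eq_bot']
  intro u hu
  have hu' : ∀ j ∈ F, c.inj j ≫ r.r ≫ u = 0 := fun j hj => by
    have := congrFun hu ⟨j, hj⟩
    simpa using this
  rw [← Category.id_comp u, ← r.retract, ← hF, cofanTrunc, Preadditive.comp_sum,
    Preadditive.sum_comp, Preadditive.sum_comp]
  refine Finset.sum_eq_zero fun j hj => ?_
  simp only [Category.assoc, hu' j hj, comp_zero]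

variable [HasZeroObject C] [HasShift C ℤ] [∀ n : ℤ, (shiftFunctor C n).Additive]
  [Pretriangulated C] {X Y Z : C} {f : X ⟶ Y} {g : Y ⟶ Z} {h : Z ⟶ X⟦(1 : ℤ)⟧}

lemma finite_hom_to_mid (hT : Triangle.mk f g h ∈ distTriang C) {N : C}
    (h₁ : Module.Finite k (N ⟶ X)) (h₃ : Module.Finite k (N ⟶ Z)) : Module.Finite k (N ⟶ Y) :=
  finite_of_ker_le_range k (Linear.rightComp k N f) (Linear.rightComp k N g)
    fun u hu => dist_lift₂ hT u hu

lemma finite_hom_to_mid_of_homZero (hT : Triangle.mk f g h ∈ distTriang C) {N : C}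
    (h₁ : HomZero N X) (h₃ : Module.Finite k (N ⟶ Z)) : Module.Finite k (N ⟶ Y) :=
  finite_hom_to_mid k hT (h₁.finite k) h₃

lemma finite_hom_from_third_of_homZero (hT : Triangle.mk f g h ∈ distTriang C) {W : C}
    (h₁ : HomZero (X⟦(1 : ℤ)⟧) W) (h₂ : Module.Finite k (Y ⟶ W)) : Module.Finite k (Z ⟶ W) := by
  have := h₁.finite k
  exact finite_of_ker_le_range k (Linear.leftComp k W h) (Linear.leftComp k W g)
    fun u hu => dist_desc₃ hT u hu

lemma finite_hom_from_first [∀ n : ℤ, (shiftFunctor C n).Linear k]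
    (hT : Triangle.mk f g h ∈ distTriang C) {W : C}
    (h₂ : Module.Finite k (Y ⟶ W)) (h₃ : Module.Finite k (Z ⟶ W⟦(1 : ℤ)⟧)) :
    Module.Finite k (X ⟶ W) :=
  finite_of_ker_le_range k (Linear.leftComp k W f)
    ((Linear.leftComp k (W⟦(1 : ℤ)⟧) h).comp ((shiftFunctor C (1 : ℤ)).mapLinearMap k))
    fun u hu => dist_desc₁ hT u hu

end Finite

lemma SiltingLT.coproduct {C : Type u} [Category.{v} C] [Preadditive C] [HasShift C ℤ]
    [∀ n : ℤ, (shiftFunctor C n).Additive] {M : C} (hM : compactObjects C M) {J : Type v} {s : C} {a : ℤ}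
    (hs : SiltingLT M a s) {c : Cofan (fun _ : J => s)} (hc : IsColimit c) : SiltingLT M a c.pt :=
  fun j hj => HomZero.coproduct hc (hM.shift j) fun _ => hs j hj

/-! ### Resolutions by finite sums of copies of `M`. -/

section Cover

variable (k : Type w) [Field k]
  {C : Type u} [Category.{v} C] [Preadditive C] [Linear k C] [HasZeroObject C] [HasShift C ℤ]
  [∀ n : ℤ, (shiftFunctor C n).Additive] [Pretriangulated C] {M : C}

/-- If `X` is connective and `Hom(M, X)` is finite-dimensional, there is a triangle
`X' ⟶ P ⟶ X ⟶ X'⟦1⟧` with `P` a finite sum of copies of `M` and `X'` connective. -/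
lemma exists_cover (hC : IsCompactlyGenerated C) (hM : IsCompactSilting M) {X : C}
    (hX : SiltingGE M 0 X) [Module.Finite k (M ⟶ X)] :
    ∃ (X' P : C) (f : X' ⟶ P) (g : P ⟶ X) (h : X ⟶ X'⟦(1 : ℤ)⟧),
      Triangle.mk f g h ∈ distTriang C ∧ SiltingGE M 0 X' ∧
      (∀ Y, HomZero M Y → HomZero P Y) ∧
      (∀ Y, Module.Finite k (M ⟶ Y) → Module.Finite k (P ⟶ Y)) ∧
      (∀ {J : Type v} {A : J → C} {c : Cofan A} (hc : IsColimit c) (u : P ⟶ c.pt),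
        ∃ F : Finset J, u ≫ cofanTrunc hc F = u) := by
  obtain ⟨n, b, hb⟩ := Module.Finite.exists_fin (R := k) (M := M ⟶ X)
  have : HasColimitsOfShape (Discrete (Fin n)) C := by
    have := hC.hasCoproducts (ULift.{v} (Fin n))
    exact hasColimitsOfShape_of_equivalence (Discrete.equivalence Equiv.ulift.{v})
  let A : Fin n → C := fun _ => M
  let c : Cofan A := Cofan.mk (∐ A) (Sigma.ι A)
  let hc : IsColimit c := coproductIsCoproduct A
  let g : c.pt ⟶ X := Cofan.IsColimit.desc hc b
  obtain ⟨X', f, h, hT⟩ := distinguished_cocone_triangle₁ g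
  have hsurj (u : M ⟶ X) : ∃ v, v ≫ g = u := by
    have hu : u ∈ Submodule.span k (Set.range b) := hb ▸ Submodule.mem_top
    have : Submodule.span k (Set.range b) ≤ LinearMap.range (Linear.rightComp k M g) := by
      rw [Submodule.span_le]
      rintro _ ⟨i, rfl⟩
      exact ⟨c.inj i, Cofan.IsColimit.fac hc b i⟩
    exact this hu
  refine ⟨X', c.pt, f, g, h, hT, fun j hj u => ?_, fun Y hY u => ?_, fun Y hY => ?_,
    fun {J A'} c' hc' u => ?_⟩
  · have hu : u ≫ f = 0 :=
      HomZero.coproduct hc (hM.compact.shift j)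
        (fun _ => (homZero_shift_iff_neg _ _ _).2 (hM.hom_shift_eq_zero _ (by omega))) _
    apply (shiftFunctor C (1 : ℤ)).map_injective
    obtain ⟨w, hw⟩ := dist_lift₁ hT (u⟦(1 : ℤ)⟧')
      (by rw [← Functor.map_comp, hu, Functor.map_zero])
    -- For `j = -1` the lift exists because the generators `b` make Hom(M, P) → Hom(M, X)
    -- surjective; for `j < -1` the morphism `w` is zero.
    obtain ⟨v, rfl⟩ : ∃ v, v ≫ g = w := by
      rcases (show j + 1 ≤ 0 by omega).eq_or_lt with h' | h'
      · let e : M⟦j⟧⟦(1 : ℤ)⟧ ≅ M := (shiftFunctorCompIsoId C j 1 h').app M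
        obtain ⟨v, hv⟩ := hsurj (e.inv ≫ w)
        exact ⟨e.hom ≫ v, by rw [Category.assoc, hv, Iso.hom_inv_id_assoc]⟩
      · have hz : HomZero (M⟦j⟧⟦(1 : ℤ)⟧) X :=
          (hX (j + 1) h').of_iso ((shiftFunctorAdd C j 1).app M) (Iso.refl _)
        exact ⟨0, by rw [hz w, zero_comp]⟩
    rw [← hw, Category.assoc, dist_comp₂₃ hT, comp_zero, Functor.map_zero]
  · exact Cofan.IsColimit.hom_ext hc _ _ fun i => (hY _).trans (hY _).symm
  · refine Module.Finite.of_injective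
      (LinearMap.pi fun i : Fin n => Linear.leftComp k Y (c.inj i)) fun u v huv => ?_
    exact Cofan.IsColimit.hom_ext hc _ _ fun i => congrFun huv i
  · classical
    have := hM.compact.preserves J
    choose F hF using fun i => exists_comp_cofanTrunc hc' M (c.inj i ≫ u)
    refine ⟨Finset.univ.biUnion F, Cofan.IsColimit.hom_ext hc _ _ fun i => ?_⟩
    rw [← Category.assoc]
    exact comp_cofanTrunc_of_subset hc' (Finset.subset_biUnion_of_mem F (Finset.mem_univ i)) (hF i)

/-- Compactness gives `F` on the cover `P`. The discrepancy on `X` then factors through `X'⟦1⟧`,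
which lives in degrees ≥ 1, where the coproduct has nothing. -/
lemma exists_comp_cofanTrunc_of_finite (hC : IsCompactlyGenerated C) (hM : IsCompactSilting M)
    {s : C} (hs : SiltingLT M 1 s) {X : C} (hX : SiltingGE M 0 X) [Module.Finite k (M ⟶ X)]
    {J : Type v} {c : Cofan (fun _ : J => s)} (hc : IsColimit c) (u : X ⟶ c.pt) :
    ∃ F : Finset J, u ≫ cofanTrunc hc F = u := by
  obtain ⟨X', P, f, g, h, hT, hX', -, -, hP⟩ := exists_cover k hC hM hX
  obtain ⟨F, hF⟩ := hP hc (g ≫ u)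
  refine ⟨F, sub_eq_zero.1 ?_⟩
  obtain ⟨v, hv⟩ := dist_desc₃ hT (u ≫ cofanTrunc hc F - u) (by
    rw [Preadditive.comp_sub, ← Category.assoc, hF, sub_self])
  rw [← hv, homZero_of_siltingGE_of_siltingLT hC hM (hX'.shift 1 1 rfl)
    (hs.coproduct hM.compact hc) v, comp_zero]

variable {s : C} [∀ n : ℤ, (shiftFunctor C n).Linear k]

/-- An object `X` of the heart filtered by `Add s` with `Hom(X, s)` finite-dimensional has
finite-dimensional `Hom(M, X)`. -/
lemma HasFiniteFiltration.finite_hom (hC : IsCompactlyGenerated C) (hM : IsCompactSilting M)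
    (hs : siltingHeart M s) (hMs : Module.Finite k (M ⟶ s))
    (hss : Module.Finite k (s ⟶ s⟦(1 : ℤ)⟧)) {x : (siltingHeart M).FullSubcategory}
    (hx : HasFiniteFiltration (siltingHeart M) (addClosure s) x) :
    Module.Finite k (x.obj ⟶ s) → Module.Finite k (M ⟶ x.obj) := by
  obtain ⟨hs₀, hs₁⟩ := siltingHeart_iff.1 hs
  refine HasFiniteFiltration.induction hC hM
    (fun X => Module.Finite k (X ⟶ s) → Module.Finite k (M ⟶ X)) ?_ ?_ ?_ hx
  · intro X Y e h hY
    have := h (finite_hom_of_iso k e.symm (Iso.refl s))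
    exact finite_hom_of_iso k (Iso.refl M) e
  · exact fun X hX _ => HomZero.finite k fun f => hX.eq_zero_of_tgt f
  · rintro X Y Z f g h hT hX hZ ⟨J, c, ⟨hc⟩, ⟨r⟩⟩ ih hY
    obtain ⟨hX₀, -⟩ := siltingHeart_iff.1 hX
    obtain ⟨hZ₀, -⟩ := siltingHeart_iff.1 hZ
    -- Finiteness of Hom(Y, s) passes to Hom(Z, s), then to Hom(M, Z). Hence `Z` is a retract of a
    -- finite sum of copies of `s`, so Hom(Z, s[1]) is finite-dimensional, which is what Hom(X, s)
    -- needs for the induction hypothesis.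
    have hZs : Module.Finite k (Z ⟶ s) := finite_hom_from_third_of_homZero k hT
      (homZero_of_siltingGE_of_siltingLT hC hM (hX₀.shift 1 1 rfl) hs₁) hY
    have hMZ : Module.Finite k (M ⟶ Z) := finite_hom_of_retract k hM.compact hc r
    obtain ⟨F, hF⟩ := exists_comp_cofanTrunc_of_finite k hC hM hs₁ hZ₀ hc r.i
    have hZs' : Module.Finite k (Z ⟶ s⟦(1 : ℤ)⟧) :=
      finite_hom_of_retract_of_comp_cofanTrunc k hc r hF
    exact finite_hom_to_mid k hT (ih (finite_hom_from_first k hT hY hZs')) hMZ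

/-- Only the degree zero truncation `V` of `X` matters: Hom(M, X) embeds into Hom(M, V), and Hom(V,
s) into Hom(X, s). -/
lemma finite_hom_of_siltingGE (hC : IsCompactlyGenerated C) (hM : IsCompactSilting M)
    (hs : siltingHeart M s) (hMs : Module.Finite k (M ⟶ s))
    (hss : Module.Finite k (s ⟶ s⟦(1 : ℤ)⟧))
    (hfilt : ∀ x : (siltingHeart M).FullSubcategory,
      HasFiniteFiltration (siltingHeart M) (addClosure s) x)
    {X : C} (hX : SiltingGE M 0 X) (hXs : Module.Finite k (X ⟶ s)) : Module.Finite k (M ⟶ X) := by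
  obtain ⟨U, V, f, g, h, hT, hU, hV⟩ := exists_truncation hC hM 1 X
  have hV₀ : SiltingGE M 0 V := fun j hj =>
    HomZero.third hT (hU.shift 1 2 rfl j (by omega)) (hX j hj)
  refine finite_hom_to_mid_of_homZero k hT
    ((hU 0 one_pos).of_iso ((shiftFunctorZero C ℤ).app M) (Iso.refl _)) ?_
  refine (hfilt ⟨V, siltingHeart_iff.2 ⟨hV₀, hV⟩⟩).finite_hom k hC hM hs hMs hss ?_
  exact finite_hom_from_third_of_homZero k hT (homZero_of_siltingGE_of_siltingLT hC hM
    (hU.shift 1 2 rfl) ((siltingHeart_iff.1 hs).2.of_le (by omega))) hXs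

/-- Morphisms from `X` to a shifted coproduct of copies of `s` factor through finite
subcoproducts. -/
lemma exists_comp_shift_cofanTrunc (hC : IsCompactlyGenerated C) (hM : IsCompactSilting M)
    (hs : siltingHeart M s) (hMs : ∀ i : ℤ, Module.Finite k (M ⟶ s⟦i⟧))
    (hss : Module.Finite k (s ⟶ s⟦(1 : ℤ)⟧))
    (hfilt : ∀ x : (siltingHeart M).FullSubcategory,
      HasFiniteFiltration (siltingHeart M) (addClosure s) x)
    {J : Type v} {c : Cofan (fun _ : J => s)} (hc : IsColimit c) (m : ℕ) :
    ∀ {X : C}, SiltingGE M 0 X → (∀ i : ℕ, Module.Finite k (X ⟶ s⟦(i : ℤ)⟧)) →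
      ∀ u : X ⟶ c.pt⟦(m : ℤ)⟧, ∃ F : Finset J, u ≫ (cofanTrunc hc F)⟦(m : ℤ)⟧' = u := by
  have hMs₀ : Module.Finite k (M ⟶ s) :=
    have := hMs 0
    finite_hom_of_iso k (Iso.refl M) ((shiftFunctorZero C ℤ).app s)
  have hs₁ := (siltingHeart_iff.1 hs).2
  have hfin {X : C} (hX : SiltingGE M 0 X) (hXs : ∀ i : ℕ, Module.Finite k (X ⟶ s⟦(i : ℤ)⟧)) :
      Module.Finite k (M ⟶ X) := by
    refine finite_hom_of_siltingGE k hC hM hs hMs₀ hss hfilt hX ?_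
    have := hXs 0
    exact finite_hom_of_iso k (Iso.refl X) ((shiftFunctorZero C ℤ).app s)
  induction m with
  | zero =>
    intro X hX hXs u
    have := hfin hX hXs
    obtain ⟨F, hF⟩ := exists_comp_cofanTrunc_of_finite k hC hM hs₁ hX hc
      (u ≫ (shiftFunctorZero C ℤ).hom.app c.pt)
    refine ⟨F, ?_⟩
    rw [← cancel_mono ((shiftFunctorZero C ℤ).hom.app c.pt)]
    conv_rhs => rw [← hF]
    rw [Category.assoc, Category.assoc]
    exact congrArg (u ≫ ·) ((shiftFunctorZero C ℤ).hom.naturality (cofanTrunc hc F))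
  | succ m ih =>
    intro X hX hXs u
    have := hfin hX hXs
    obtain ⟨X', P, f, g, h, hT, hX', hP₁, hP₂, -⟩ := exists_cover k hC hM hX
    -- Hom(X', s[i]) lies between Hom(P, s[i]) and Hom(X, s[i + 1]), so the finiteness hypothesis
    -- has to be carried for all `i`.
    have hX's (i : ℕ) : Module.Finite k (X' ⟶ s⟦(i : ℤ)⟧) := by
      refine finite_hom_from_first k hT (hP₂ _ (hMs i)) ?_
      have := hXs (i + 1)
      exact finite_hom_of_iso k (Iso.refl X)
        ((shiftFunctorAdd' C (i : ℤ) 1 ((i + 1 : ℕ) : ℤ) (by push_cast; rfl)).app s)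
    have hMc : HomZero M (c.pt⟦((m + 1 : ℕ) : ℤ)⟧) :=
      HomZero.shift_coproduct hc hM.compact fun _ => hs _ (by omega)
    -- Dimension shift: `u` vanishes on `P`, so it comes from a morphism out of `X'⟦1⟧`, to which
    -- the case `m` applies after unshifting.
    obtain ⟨v, rfl⟩ := dist_desc₃ hT u (hP₁ _ hMc _)
    let e := shiftFunctorAdd' C (m : ℤ) 1 ((m + 1 : ℕ) : ℤ) (by push_cast; rfl)
    obtain ⟨v', hv'⟩ := (shiftFunctor C (1 : ℤ)).map_surjective (v ≫ e.hom.app c.pt)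
    obtain ⟨F, hF⟩ := ih hX' hX's v'
    refine ⟨F, ?_⟩
    rw [Category.assoc, ← cancel_mono (e.hom.app c.pt)]
    have h₁ := congrArg (fun t => t⟦(1 : ℤ)⟧') hF
    have h₂ := e.hom.naturality (cofanTrunc hc F)
    simp only [Functor.map_comp, hv', Category.assoc] at h₁ ⊢
    rw [h₂]
    exact congrArg (h ≫ ·) h₁

end Cover

/-! ### Finiteness and vanishing from Serre duality. -/

section Dual

variable {k : Type w} [Field k]

open Cardinal in
/-- If `V ≃ U^∨` and `U ≃ W^∨` and `V` is in bijection with `W`, then `V` is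
finite-dimensional. -/
lemma finite_of_equiv_dual_dual {V U W : Type v} [AddCommGroup V] [Module k V] [AddCommGroup U]
    [Module k U] [AddCommGroup W] [Module k W] (e₁ : V ≃ₗ[k] Module.Dual k U)
    (e₂ : U ≃ₗ[k] Module.Dual k W) (e : V ≃ W) : Module.Finite k V := by
  -- By Erdős–Kaplansky an infinite-dimensional dual has dimension equal to its cardinality, which
  -- exceeds the dimension of the original space. Thus #V = #U^∨ > dim U = dim W^∨ = #W^∨ ≥ #W,
  -- against #V = #W.
  by_contra hV
  have hU : ¬ Module.Finite k U := fun _ => hV (Module.Finite.equiv e₁.symm)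
  have hW : ¬ Module.Finite k W := fun _ => hU (Module.Finite.equiv e₂.symm)
  rw [← Module.rank_lt_aleph0_iff, not_lt] at hU hW
  have h₁ : lift.{w} #V = #(Module.Dual k U) := by
    have := Cardinal.mk_congr_lift e₁.toEquiv
    rwa [lift_umax.{v, w}, lift_id'.{v, w}] at this
  have h₂ : lift.{w} (Module.rank k U) = Module.rank k (Module.Dual k W) := by
    have := e₂.lift_rank_eq
    rwa [lift_umax.{v, w}, lift_id'.{v, w}] at this
  have h₃ := lift_rank_lt_rank_dual hU
  have h₄ := rank_dual_eq_card_dual_of_aleph0_le_rank hU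
  have h₅ := rank_dual_eq_card_dual_of_aleph0_le_rank hW
  have h₆ : lift.{w} #W ≤ #(Module.Dual k W) := by
    classical
    simpa using Cardinal.mk_le_of_injective
      ((Module.Basis.toDual_injective (Module.Free.chooseBasis k W)).comp
        Equiv.ulift.{w}.injective)
  have h₇ : lift.{w} #V = lift.{w} #W := by rw [Cardinal.mk_congr e]
  have h₈ : lift.{w} #W < lift.{w} #V :=
    calc lift.{w} #W ≤ #(Module.Dual k W) := h₆
      _ = lift.{w} (Module.rank k U) := by rw [h₂]; exact h₅.symm
      _ < #(Module.Dual k U) := h₃.trans_eq h₄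
      _ = lift.{w} #V := h₁.symm
  exact h₈.ne h₇.symm

lemma finite_component {ι : Type*} [DecidableEq ι] (V : ι → Type*) [∀ i, AddCommGroup (V i)]
    [∀ i, Module k (V i)] [Module.Finite k (⨁ i, V i)] (i : ι) : Module.Finite k (V i) :=
  Module.Finite.of_surjective (DirectSum.component k ι V i) fun x =>
    ⟨DirectSum.lof k ι V i x, DirectSum.component.lof_self k i x⟩

lemma exists_finset_subsingleton {ι : Type*} [DecidableEq ι] (V : ι → Type*)
    [∀ i, AddCommGroup (V i)] [∀ i, Module k (V i)] [Module.Finite k (⨁ i, V i)] :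
    ∃ F : Finset ι, ∀ i ∉ F, Subsingleton (V i) := by
  classical
  obtain ⟨n, b, hb⟩ := Module.Finite.exists_fin (R := k) (M := ⨁ i, V i)
  refine ⟨Finset.univ.biUnion fun j => DFinsupp.support (b j), fun i hi => ?_⟩
  have h0 : DirectSum.component k ι V i = 0 := by
    refine LinearMap.ext_on hb ?_
    rintro _ ⟨j, rfl⟩
    by_contra h
    exact hi (Finset.mem_biUnion.2 ⟨j, Finset.mem_univ j, DFinsupp.mem_support_iff.2 h⟩)
  have h (x : V i) : x = 0 := by
    rw [← DirectSum.component.lof_self k i x, h0, LinearMap.zero_apply]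
  exact ⟨fun x y => (h x).trans (h y).symm⟩

namespace SerreFunctor

variable {D : Type u} [Category.{v} D] [Preadditive D] [Linear k D] [HasZeroObject D]
  [HasShift D ℤ] [∀ n : ℤ, (shiftFunctor D n).Additive] [Pretriangulated D]
  (S : SerreFunctor k D)

-- Duality twice compares Hom(X, Y) with the double dual of Hom(S X, S Y). The bijection between
-- these two spaces given by `S` need not be linear, so the comparison is of cardinalities.
include S in
lemma finite_hom (X Y : D) : Module.Finite k (X ⟶ Y) :=
  have := S.isEquivalence
  finite_of_equiv_dual_dual (S.dualIso X Y) (S.dualIso Y (S.functor.obj X))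
    (Functor.FullyFaithful.ofFullyFaithful S.functor).homEquiv

lemma homZero {X Y : D} (h : HomZero Y (S.functor.obj X)) : HomZero X Y := fun f => by
  apply (S.dualIso X Y).injective
  ext g
  rw [h g, map_zero, map_zero]

end SerreFunctor

end Dual

/-! ### Vanishing for `s`, for Add s and for the heart. -/

section Shift

variable {k : Type w} [Field k] {C : Type u} [Category.{v} C] [Preadditive C] [HasShift C ℤ]
  {M s : C}

lemma HomZero.of_addClosure {m : ℤ}
    (h : ∀ {J : Type v} {c : Cofan (fun _ : J => s)}, IsColimit c → HomZero s (c.pt⟦m⟧))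
    {X Y : C} (hX : addClosure s X) (hY : addClosure s Y) : HomZero X (Y⟦m⟧) := by
  obtain ⟨J, c, ⟨hc⟩, ⟨r⟩⟩ := hX
  obtain ⟨J', c', ⟨hc'⟩, ⟨r'⟩⟩ := hY
  intro f
  have h0 : r.r ≫ f ≫ r'.i⟦m⟧' = 0 :=
    Cofan.IsColimit.hom_ext hc _ _ fun j => (h hc' _).trans (h hc' _).symm
  have h1 : 𝟙 X ≫ f ≫ (𝟙 Y)⟦m⟧' = 0 := by
    rw [← r.retract, ← r'.retract, Functor.map_comp, Category.assoc, ← Category.assoc f,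
      ← Category.assoc r.r, h0, zero_comp, comp_zero]
  simpa using h1

lemma globalDim_lt_top (H : ObjectProperty C) (n : ℤ)
    (h : ∀ {X Y : C}, H X → H Y → ∀ m, n < m → HomZero X (Y⟦m⟧)) : globalDim H < ⊤ := by
  refine lt_of_le_of_lt (b := ((n : WithTop ℤ) : WithBot (WithTop ℤ))) (sInf_le ?_) ?_
  · exact ⟨n, fun x hx => sInf_le ⟨n, fun y hy m hm => h hx hy m hm, rfl⟩, rfl⟩
  · exact WithBot.coe_lt_coe.2 (WithTop.coe_lt_top n)

variable [∀ n : ℤ, (shiftFunctor C n).Additive]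

lemma HomZero.shift_of_comp_cofanTrunc {N s : C} {m : ℤ} (h : HomZero N (s⟦m⟧)) {J : Type*}
    {c : Cofan (fun _ : J => s)} (hc : IsColimit c)
    (hf : ∀ f : N ⟶ c.pt⟦m⟧, ∃ F : Finset J, f ≫ (cofanTrunc hc F)⟦m⟧' = f) :
    HomZero N (c.pt⟦m⟧) := fun f => by
  obtain ⟨F, hF⟩ := hf f
  rw [← hF, cofanTrunc, Functor.map_sum, Preadditive.comp_sum]
  refine Finset.sum_eq_zero fun j _ => ?_
  rw [Functor.map_comp, ← Category.assoc, h (f ≫ _), zero_comp]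

lemma boundedFinite.exists_siltingLT [Linear k C] (hM : compactObjects C M) {Z : C}
    (hZ : boundedFinite k C Z) : ∃ b : ℤ, SiltingLT M b Z := by
  have := hZ M hM
  obtain ⟨F, hF⟩ := exists_finset_subsingleton (k := k) fun n : ℤ => (M ⟶ Z⟦n⟧)
  obtain ⟨B, hB⟩ := F.bddBelow
  refine ⟨1 - B, fun j hj => (homZero_shift_iff_neg _ _ _).2 fun f => ?_⟩
  have := hF (-j) fun h => by
    have := hB h
    omega
  exact Subsingleton.elim _ _

end Shift

section Vanishing

variable {k : Type w} [Field k]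
  {C : Type u} [Category.{v} C] [Preadditive C] [Linear k C] [HasZeroObject C] [HasShift C ℤ]
  [∀ n : ℤ, (shiftFunctor C n).Additive] [Pretriangulated C] {M s : C}

lemma finite_hom_boundedFinite (S : SerreFunctor k (boundedFinite k C).FullSubcategory)
    {X Y : C} (hX : boundedFinite k C X) (hY : boundedFinite k C Y) : Module.Finite k (X ⟶ Y) := by
  have := S.finite_hom ⟨X, hX⟩ ⟨Y, hY⟩
  exact Module.Finite.of_surjective ((boundedFinite k C).ι.mapLinearMap k
    (X := ⟨X, hX⟩) (Y := ⟨Y, hY⟩)) (boundedFinite k C).ι.map_surjective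

/-- Hom(s, s[m]) is dual to Hom(s[m], S s), and S s has nothing in degrees ≥ `b`, whereas s[m] lives
in degrees ≥ `m`. -/
lemma exists_homZero_shift (hC : IsCompactlyGenerated C) (hM : IsCompactSilting M)
    (hs : siltingHeart M s) (hsb : boundedFinite k C s)
    (S : SerreFunctor k (boundedFinite k C).FullSubcategory) :
    ∃ b : ℤ, ∀ m, b ≤ m → HomZero s (s⟦m⟧) := by
  let s' : (boundedFinite k C).FullSubcategory := ⟨s, hsb⟩
  obtain ⟨b, hb⟩ := boundedFinite.exists_siltingLT hM.compact (S.functor.obj s').property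
  refine ⟨b, fun m hm f => ?_⟩
  let e : (s'⟦m⟧).obj ≅ s⟦m⟧ := ((boundedFinite k C).ι.commShiftIso m).app s'
  have h₁ : HomZero (s'⟦m⟧) (S.functor.obj s') := fun g => by
    ext
    exact (homZero_of_siltingGE_of_siltingLT hC hM ((siltingHeart_iff.1 hs).1.shift m m (zero_add m))
      (hb.of_le hm)).of_iso e.symm (Iso.refl _) g.hom
  let f' : s' ⟶ s'⟦m⟧ := ObjectProperty.homMk (f ≫ e.inv)
  have h₂ : f ≫ e.inv = 0 := congrArg (fun t => t.hom) (S.homZero h₁ f')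
  rw [← cancel_mono e.inv, h₂, zero_comp]

lemma HomZero.from_mid {X Y Z : C} {f : X ⟶ Y} {g : Y ⟶ Z} {h : Z ⟶ X⟦(1 : ℤ)⟧}
    (hT : Triangle.mk f g h ∈ distTriang C) {W : C} (hX : HomZero X W) (hZ : HomZero Z W) :
    HomZero Y W := fun u => by
  obtain ⟨v, rfl⟩ := dist_desc₂ hT u (hX _)
  rw [hZ v, comp_zero]

lemma homZero_shift_of_hasFiniteFiltration (hC : IsCompactlyGenerated C) (hM : IsCompactSilting M)
    (hfilt : ∀ x : (siltingHeart M).FullSubcategory,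
      HasFiniteFiltration (siltingHeart M) (addClosure s) x) {m : ℤ}
    (h : ∀ {X Y : C}, addClosure s X → addClosure s Y → HomZero X (Y⟦m⟧))
    {X Y : C} (hX : siltingHeart M X) (hY : siltingHeart M Y) : HomZero X (Y⟦m⟧) := by
  have key (Z : C) (hZ : addClosure s Z) : HomZero X (Z⟦m⟧) :=
    (hfilt ⟨X, hX⟩).induction hC hM (fun X => HomZero X (Z⟦m⟧))
      (fun e h => h.of_iso e (Iso.refl _)) (fun X hX f => hX.eq_zero_of_src f)
      (fun f g δ hT _ _ hA hX' => HomZero.from_mid hT hX' (h hA hZ))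
  refine (hfilt ⟨Y, hY⟩).induction hC hM (fun Y => HomZero X (Y⟦m⟧))
    (fun e h => h.of_iso (Iso.refl _) ((shiftFunctor C m).mapIso e))
    (fun Y hY f => ((shiftFunctor C m).map_isZero hY).eq_zero_of_tgt f)
    (fun f g δ hT _ _ hA hX' => ?_)
  rw [homZero_shift_right_iff] at hX' ⊢
  exact HomZero.mid hT hX' ((homZero_shift_right_iff _ _ _).1 (key _ hA))

end Vanishing

end RelGlobalDim

theorem lemma2p21 (k : Type w) [Field k]
    (T : Type u) [Category.{v} T] [Preadditive T] [Linear k T] [HasZeroObject T] [HasShift T ℤ]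
    [∀ n : ℤ, (shiftFunctor T n).Additive] [∀ n : ℤ, (shiftFunctor T n).Linear k]
    [Pretriangulated T] [IsTriangulated T]
    (hT : RelGlobalDim.IsCompactlyGenerated T)
    (M : T) (hM : RelGlobalDim.IsCompactSilting M)
    (s : T) (hsH : RelGlobalDim.siltingHeart M s) (hsb : RelGlobalDim.boundedFinite k T s)
    (hfilt : ∀ x : (RelGlobalDim.siltingHeart M).FullSubcategory,
      RelGlobalDim.HasFiniteFiltration (RelGlobalDim.siltingHeart M)
        (RelGlobalDim.addClosure s) x)
    (hcoprod : ∀ J : Type v, PreservesColimitsOfShape (Discrete J)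
      ((RelGlobalDim.siltingHeart M).ι ⋙ preadditiveCoyoneda.obj (Opposite.op s)))
    (hS : Nonempty (RelGlobalDim.SerreFunctor k (RelGlobalDim.boundedFinite k T).FullSubcategory)) :
    RelGlobalDim.globalDim (RelGlobalDim.siltingHeart M) < ⊤ := by
  obtain ⟨S⟩ := hS
  obtain ⟨b, hb⟩ := RelGlobalDim.exists_homZero_shift hT hM hsH hsb S
  have hss (i : ℤ) : Module.Finite k (s ⟶ s⟦i⟧) :=
    RelGlobalDim.finite_hom_boundedFinite S hsb ((RelGlobalDim.boundedFinite k T).le_shift i _ hsb)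
  have hMs (i : ℤ) : Module.Finite k (M ⟶ s⟦i⟧) :=
    have := hsb M hM.compact
    RelGlobalDim.finite_component (k := k) (fun n : ℤ => (M ⟶ s⟦n⟧)) i
  -- The bound `b` comes from Serre duality; the maximum with 0 makes `m` a natural number, as the
  -- dimension shift by induction on `m` requires.
  refine RelGlobalDim.globalDim_lt_top _ (max b 0) fun hX hY m hm => ?_
  lift m to ℕ using by omega
  refine RelGlobalDim.homZero_shift_of_hasFiniteFiltration hT hM hfilt
    (RelGlobalDim.HomZero.of_addClosure fun hc => ?_) hX hY
  exact RelGlobalDim.HomZero.shift_of_comp_cofanTrunc (hb m (by omega)) hc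
    (RelGlobalDim.exists_comp_shift_cofanTrunc k hT hM hsH hMs (hss 1) hfilt hc m
      (RelGlobalDim.siltingHeart_iff.1 hsH).1 fun i => hss i)
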